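/- All graphs are finite and simple. A \emph{cograph} is a graph with no induced path on four vertices. Let $G=(V,E)$ be a cograph and let $T$ be its \emph{cotree}: the rooted tree whose leaves are the vertices of $G$, whose internal nodes are labelled \emph{parallel} or \emph{series}, have at least two children each, and are such that no two adjacent nodes have the same label, and in which two distinct vertices of $G$ are adjacent iff their lowest common ancestor is a series node. For a node $u$ of $T$, let $V(u)$ be the set of leaves of the subtree rooted at $u$ (so $V(u)=\{u\}$ if $u$ is a leaf). Let $x\notin V$ be a new vertex, let $N(x)\subseteq V$, and let $G+x$ be the graph obtained from $G$ by adding $x$ with neighbourhood $N(x)$. For $N\subseteq V$, a node $u$ is \emph{full} w.r.t. $N$ if $V(u)\subseteq N$, \emph{hollow} if $V(u)\cap N=\varnothing$, \emph{uniform} if it is full or hollow, and \emph{mixed} otherwise; when no set is mentioned, $N=N(x)$ is meant. A \emph{constrained completion} of $G+x$ is a cograph $H$ obtained from $G+x$ by adding only edges incident to $x$; it is \emph{minimal} if it is minimal for inclusion of edge sets among the constrained completions. A node $u$ is the \emph{insertion node} associated to a constrained completion $H$ if, for $N'=N_H(x)$, the node $u$ is mixed w.r.t. $N'$, all children of $u$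 are uniform w.r.t. $N'$, and for all $y\in V\setminus V(u)$ one has $y\in N'$ iff the lowest common ancestor of $y$ and $u$ is a series node. A node $u$ is a \emph{completion-minimal insertion node} if it is the insertion node associated to some minimal constrained completion of $G+x$. A node $u$ is \emph{eligible} if, for every strict ancestor $v$ of $u$ that is a parallel node, all children of $v$ other than the one that is $u$ or an ancestor of $u$ are hollow. The \emph{completion-forced} nodes are defined inductively: $u$ is completion-forced iff $u$ is full, or $u$ is a parallel node all of whose children are non-hollow, or $u$ is a series node all of whose children are completion-forced. \textbf{Lemma.} A node $u$ of $T$ is a completion-minimal insertion node if and only if $u$ is eligible, non-hollow and non-completion-forced, and in addition one of the following two conditions holds: \begin{enumerate} \item $u$ is a series node and has at least one hollow child; or \item $u$ is a parallel node and has no child that is both eligible and non-completion-forced. \end{enumerate} -/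

import Mathlib

/-- A graph is a cograph if it has no induced path on four vertices. -/
def IsCograph {V : Type*} (G : SimpleGraph V) : Prop :=
  ¬ (SimpleGraph.pathGraph 4).IsIndContained G

/-- The kind of a cotree node: a leaf, a parallel node or a series node. -/
inductive NodeKind where
  | leaf
  | parallel
  | series

/-- A cotree of the graph `G`. The underlying rooted tree is ordered from the root `⊥` downwards:
`v ≤ u` means that `v` is an ancestor of `u` (possibly `u` itself), `u ⋖ v` means that `v` is a
child of `u`, and `u ⊓ v` is the lowest common ancestor of `u` and `v`. -/
structure Cotree.{u, v} {V : Type u} (G : SimpleGraph V) where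
  /-- the underlying rooted tree -/
  tree : RootedTree.{v}
  /-- the tree is finite -/
  finite_tree : Finite tree
  /-- the kind of each node -/
  kind : tree → NodeKind
  /-- the leaf that carries a given vertex of `G` -/
  leaf : V → tree
  /-- distinct vertices are carried by distinct leaves -/
  leaf_injective : Function.Injective leaf
  /-- the nodes of kind `leaf` are those that carry a vertex -/
  kind_eq_leaf_iff : ∀ u : tree, kind u = NodeKind.leaf ↔ ∃ x : V, leaf x = u
  /-- a leaf has no child -/
  not_covBy_of_leaf : ∀ u v : tree, kind u = NodeKind.leaf → ¬ u ⋖ v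
  /-- every internal node has at least two children -/
  two_children : ∀ u : tree, kind u ≠ NodeKind.leaf → ∃ v w : tree, u ⋖ v ∧ u ⋖ w ∧ v ≠ w
  /-- no two parallel nodes and no two series nodes are adjacent in the tree -/
  kind_ne_of_covBy : ∀ u v : tree, u ⋖ v → kind u ≠ kind v
  /-- two vertices are adjacent iff their lowest common ancestor is a series node -/
  adj_iff : ∀ x y : V, x ≠ y → (G.Adj x y ↔ kind (leaf x ⊓ leaf y) = NodeKind.series)

/-- The graph `G + x`, where the new vertex `x = none` has neighbourhood `N`. -/
def addVertex {V : Type*} (G : SimpleGraph V) (N : Set V) : SimpleGraph (Option V) where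
  Adj
    | some a, some b => G.Adj a b
    | none, some b => b ∈ N
    | some a, none => a ∈ N
    | none, none => False
  symm := ⟨by
    rintro (_ | a) (_ | b) h
    · exact h
    · exact h
    · exact h
    · exact G.adj_symm h⟩
  loopless := ⟨by
    rintro (_ | a) h
    · exact h
    · exact G.loopless.irrefl a h⟩

/-- `H` is a constrained cograph completion of `G + x`: a cograph obtained from `G + x` by adding
only edges incident to `x = none`. -/
def IsConstrainedCompletion {V : Type*} (G : SimpleGraph V) (N : Set V)
    (H : SimpleGraph (Option V)) : Prop :=
  IsCograph H ∧ addVertex G N ≤ H ∧ ∀ a b : V, H.Adj (some a) (some b) → G.Adj a b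

/-- `H` is an inclusion-minimal constrained cograph completion of `G + x`. -/
def IsMinimalConstrainedCompletion {V : Type*} (G : SimpleGraph V) (N : Set V)
    (H : SimpleGraph (Option V)) : Prop :=
  Minimal (IsConstrainedCompletion G N) H

/-- The neighbourhood in `H` of the new vertex `x = none`. -/
def newNeighbors {V : Type*} (H : SimpleGraph (Option V)) : Set V :=
  {y | H.Adj none (some y)}

namespace Cotree

variable {V : Type*} {G : SimpleGraph V} (T : Cotree G)

/-- `V(u)`: the vertices carried by the leaves of the subtree rooted at `u`. -/
def verts (u : T.tree) : Set V := {x | u ≤ T.leaf x}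

/-- `u` is full with respect to the neighbourhood `N`. -/
def IsFull (N : Set V) (u : T.tree) : Prop := T.verts u ⊆ N

/-- `u` is hollow with respect to the neighbourhood `N`. -/
def IsHollow (N : Set V) (u : T.tree) : Prop := T.verts u ∩ N = ∅

/-- `u` is uniform with respect to the neighbourhood `N`. -/
def IsUniform (N : Set V) (u : T.tree) : Prop := T.IsFull N u ∨ T.IsHollow N u

/-- `u` is mixed with respect to the neighbourhood `N`. -/
def IsMixed (N : Set V) (u : T.tree) : Prop := ¬ T.IsFull N u ∧ ¬ T.IsHollow N u

/-- `u` is the insertion node for a new vertex whose neighbourhood is `N`. -/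
def IsInsertionNode (N : Set V) (u : T.tree) : Prop :=
  T.IsMixed N u ∧
  (∀ v : T.tree, u ⋖ v → T.IsUniform N v) ∧
  ∀ y : V, y ∉ T.verts u → (y ∈ N ↔ T.kind (T.leaf y ⊓ u) = NodeKind.series)

/-- `u` is the insertion node associated to some minimal constrained completion of `G + x`, where
the new vertex `x` has neighbourhood `N`. -/
def IsCompletionMinimalInsertionNode (N : Set V) (u : T.tree) : Prop :=
  ∃ H : SimpleGraph (Option V),
    IsMinimalConstrainedCompletion G N H ∧ T.IsInsertionNode (newNeighbors H) u

/-- `u` is eligible: for every strict ancestor `v` of `u` that is a parallel node, all the children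
of `v` that are not ancestors of `u` are hollow. -/
def IsEligible (N : Set V) (u : T.tree) : Prop :=
  ∀ v : T.tree, v < u → T.kind v = NodeKind.parallel →
    ∀ w : T.tree, v ⋖ w → ¬ w ≤ u → T.IsHollow N w

/-- Completion-forced nodes. -/
inductive IsCompletionForced (N : Set V) : T.tree → Prop
  | full (u : T.tree) (h : T.IsFull N u) : IsCompletionForced N u
  | parallel (u : T.tree) (hu : T.kind u = NodeKind.parallel)
      (h : ∀ v : T.tree, u ⋖ v → ¬ T.IsHollow N v) : IsCompletionForced N u
  | series (u : T.tree) (hu : T.kind u = NodeKind.series)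
      (h : ∀ v : T.tree, u ⋖ v → IsCompletionForced N v) : IsCompletionForced N u

end Cotree

/-! A constrained completion is determined by the neighbourhood `M ⊇ N` of the new vertex. It is a
cograph iff `M` is coherent: siblings of a mixed node are hollow under a parallel parent and full
under a series parent (`isCograph_addVertex_iff_isCoherentBelow`). Hence outside a mixed node `u`,
`M` is dictated by lowest common ancestors with `u`. Conversely, `glue` extends any set coherent
below `u` to a coherent set, and the result contains `N` if `u` is eligible and the set contains the
part of `N` below `u`. Completions can thus be modified locally.

Completion-forced nodes are full in every completion, and every other node can be left non-full
locally. Necessity: otherwise, emptying a hollow `u`, or un-filling an eligible non-forced child of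
a parallel `u`, gives a smaller completion. Sufficiency: `fillChildren` is minimal, because a
smaller completion has no mixed child of `u`, so it fills every non-hollow child and agrees outside
`u`. -/

/-- A graph is a cograph iff any four vertices that look like an induced path are closed up. -/
theorem isCograph_iff {V : Type*} {G : SimpleGraph V} :
    IsCograph G ↔ ∀ a b c d, G.Adj a b → G.Adj b c → G.Adj c d →
      ¬ G.Adj a c → ¬ G.Adj b d → G.Adj a d := by
  constructor
  · intro hG a b c d hab hbc hcd hac hbd
    by_contra had
    have hac' : a ≠ c := by rintro rfl; exact had hcd
    have hbd' : b ≠ d := by rintro rfl; exact had hab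
    have had' : a ≠ d := by rintro rfl; exact hac hcd.symm
    refine hG ⟨⟨⟨![a, b, c, d], ?_⟩, ?_⟩⟩
    · intro i j h
      fin_cases i <;> fin_cases j <;>
        simp_all [hab.ne, hbc.ne, hcd.ne, hab.ne', hbc.ne', hcd.ne', hac'.symm, hbd'.symm,
          had'.symm]
    · intro i j
      change G.Adj (![a, b, c, d] i) (![a, b, c, d] j) ↔ _
      fin_cases i <;> fin_cases j <;>
        simp [SimpleGraph.pathGraph_adj, hab, hbc, hcd, hac, hbd, had, hab.symm, hbc.symm,
          hcd.symm, mt G.adj_symm hac, mt G.adj_symm hbd, mt G.adj_symm had]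
  · rintro h ⟨e⟩
    have key : ∀ i j : Fin 4, G.Adj (e i) (e j) ↔ (SimpleGraph.pathGraph 4).Adj i j :=
      fun i j => e.map_adj_iff
    have := h (e 0) (e 1) (e 2) (e 3)
    simp [key, SimpleGraph.pathGraph_adj] at this

/-- Adding a vertex to a cograph creates an induced path on four vertices iff the new vertex is an
end or an inner vertex of such a path. -/
theorem isCograph_addVertex_iff {V : Type*} {G : SimpleGraph V} (hG : IsCograph G) (M : Set V) :
    IsCograph (addVertex G M) ↔
      (∀ a b c, G.Adj a b → G.Adj b c → ¬ G.Adj a c → a ∈ M → b ∉ M → c ∈ M) ∧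
      (∀ a b c, ¬ G.Adj a b → G.Adj b c → ¬ G.Adj a c → a ∈ M → b ∈ M → c ∈ M) := by
  rw [isCograph_iff] at hG ⊢
  constructor
  · intro h
    constructor
    · intro a b c hab hbc hac ha hb
      exact h none (some a) (some b) (some c) ha hab hbc hb hac
    · intro a b c hab hbc hac ha hb
      by_contra hc
      exact hac (h (some a) none (some b) (some c) ha hb hbc hab hc)
  · rintro ⟨h₁, h₂⟩ (_ | a) (_ | b) (_ | c) (_ | d) hab hbc hcd hac hbd
    all_goals simp only [addVertex] at *
    · exact hcd
    · exact hac hcd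
    · exact h₁ b c d hbc hcd hbd hab hac
    · exact hab
    · exact not_not.1 fun had => hbd (h₂ a c d hac hcd had hab hbc)
    · exact not_not.1 fun had => hac (h₂ d b a (fun h => hbd h.symm) hab.symm
        (fun h => had h.symm) hcd hbc)
    · exact h₁ c b a hbc.symm hab.symm (fun h => hac h.symm) hcd hbd
    · exact hG a b c d hab hbc hcd hac hbd

/-! ### Constrained completions as neighbourhoods of the new vertex. -/

theorem addVertex_le_addVertex_iff {V : Type*} {G : SimpleGraph V} {M M' : Set V} :
    addVertex G M ≤ addVertex G M' ↔ M ⊆ M' := by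
  constructor
  · intro h y hy
    exact h (show (addVertex G M).Adj none (some y) from hy)
  · rintro h (_ | a) (_ | b) hab
    · exact hab
    · exact h hab
    · exact h hab
    · exact hab

theorem IsConstrainedCompletion.eq_addVertex {V : Type*} {G : SimpleGraph V} {N : Set V}
    {H : SimpleGraph (Option V)} (h : IsConstrainedCompletion G N H) :
    H = addVertex G (newNeighbors H) := by
  ext (_ | a) (_ | b)
  · exact ⟨fun h => (H.loopless.irrefl _ h).elim, fun h => h.elim⟩
  · exact Iff.rfl
  · exact H.adj_comm _ _
  · exact ⟨h.2.2 a b, fun hab => h.2.1 (show (addVertex G N).Adj (some a) (some b) from hab)⟩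

theorem isConstrainedCompletion_addVertex_iff {V : Type*} {G : SimpleGraph V} {N M : Set V} :
    IsConstrainedCompletion G N (addVertex G M) ↔ IsCograph (addVertex G M) ∧ N ⊆ M := by
  simp only [IsConstrainedCompletion, addVertex_le_addVertex_iff]
  exact ⟨fun h => ⟨h.1, h.2.1⟩, fun h => ⟨h.1, h.2, fun _ _ hab => hab⟩⟩

theorem isMinimalConstrainedCompletion_addVertex_iff {V : Type*} {G : SimpleGraph V}
    {N M : Set V} :
    IsMinimalConstrainedCompletion G N (addVertex G M) ↔
      Minimal (fun M => IsCograph (addVertex G M) ∧ N ⊆ M) M := by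
  constructor
  · rintro ⟨h₁, h₂⟩
    refine ⟨isConstrainedCompletion_addVertex_iff.1 h₁, fun M' hM' hle => ?_⟩
    exact addVertex_le_addVertex_iff.1 (h₂ (isConstrainedCompletion_addVertex_iff.2 hM')
      (addVertex_le_addVertex_iff.2 hle))
  · rintro ⟨h₁, h₂⟩
    refine ⟨isConstrainedCompletion_addVertex_iff.2 h₁, fun H hH hle => ?_⟩
    obtain ⟨M', rfl⟩ : ∃ M', H = addVertex G M' := ⟨_, hH.eq_addVertex⟩
    exact addVertex_le_addVertex_iff.2 (h₂ (isConstrainedCompletion_addVertex_iff.1 hH)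
      (addVertex_le_addVertex_iff.1 hle))

/-! ### Lowest common ancestors in rooted trees. -/

namespace RootedTree

variable {t : RootedTree} {a b c u v w y : t}

theorem le_total_of_le (ha : a ≤ c) (hb : b ≤ c) : a ≤ b ∨ b ≤ a :=
  (le_total_of_directed ha hb).symm

/-- Two ancestors of a node, one of which is a child of `v`: the other is an ancestor of `v` or a
descendant of that child. -/
theorem le_or_le_of_covBy (hw : v ⋖ w) (hwy : w ≤ y) (hu : u ≤ y) : u ≤ v ∨ w ≤ u := by
  rcases le_total_of_le hu hwy with h | h
  · rcases le_total_of_le h hw.le with h' | h'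
    · exact Or.inl h'
    · rcases hw.eq_or_eq h' h with rfl | rfl
      · exact Or.inl le_rfl
      · exact Or.inr le_rfl
  · exact Or.inr h

theorem eq_of_covBy_of_le (hv : u ⋖ v) (hw : u ⋖ w) (hvy : v ≤ y) (hwy : w ≤ y) : v = w := by
  rcases le_or_le_of_covBy hw hwy hvy with h | h
  · exact absurd hv.lt h.not_gt
  · rcases le_or_le_of_covBy hv hvy hwy with h' | h'
    · exact absurd hw.lt h'.not_gt
    · exact le_antisymm h' h

/-- If `y` is below the child `w` of `v`, and `u` is below `v` but not below `w`, then the lowest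
common ancestor of `y` and `u` is `v`. -/
theorem inf_eq_of_covBy (hw : v ⋖ w) (hwy : w ≤ y) (hvu : v ≤ u) (hwu : ¬ w ≤ u) :
    y ⊓ u = v := by
  rcases le_or_le_of_covBy hw hwy (inf_le_left : y ⊓ u ≤ y) with h | h
  · exact le_antisymm h (le_inf (hw.le.trans hwy) hvu)
  · exact absurd (h.trans inf_le_right) hwu

/-- Two of the three pairwise lowest common ancestors of three nodes coincide. -/
theorem inf_lt_inf_of_ne (hb : a ⊓ c ≠ a ⊓ b) (hc : a ⊓ c ≠ b ⊓ c) : a ⊓ b < a ⊓ c := by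
  rcases le_total_of_le (inf_le_left : a ⊓ b ≤ a) (inf_le_left : a ⊓ c ≤ a) with h | h
  · exact lt_of_le_of_ne h hb.symm
  · exfalso
    rcases le_total_of_le (inf_le_right : a ⊓ b ≤ b) (inf_le_left : b ⊓ c ≤ b) with h' | h'
    · exact hb (le_antisymm h (le_inf inf_le_left (h'.trans inf_le_right)))
    · exact hc (le_antisymm (le_inf (h.trans inf_le_right) inf_le_right)
        (le_inf (h'.trans inf_le_left) inf_le_right))

end RootedTree

/-! ### Cotrees and full, hollow and mixed nodes. -/

namespace Cotree

open RootedTree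

variable {V : Type*} {G : SimpleGraph V} {T : Cotree G} {N M : Set V} {u v w : T.tree}

theorem exists_covBy_le (h : u < v) : ∃ w, u ⋖ w ∧ w ≤ v :=
  haveI := T.finite_tree
  exists_covBy_le_of_lt h

theorem kind_leaf (x : V) : T.kind (T.leaf x) = NodeKind.leaf :=
  (T.kind_eq_leaf_iff _).2 ⟨x, rfl⟩

theorem eq_of_kind_leaf_of_le (hu : T.kind u = NodeKind.leaf) (h : u ≤ v) : u = v := by
  by_contra hne
  obtain ⟨w, hw, -⟩ := exists_covBy_le (lt_of_le_of_ne h hne)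
  exact T.not_covBy_of_leaf u w hu hw

theorem kind_ne_leaf_of_lt (h : u < v) : T.kind u ≠ NodeKind.leaf :=
  fun hu => h.ne (eq_of_kind_leaf_of_le hu h.le)

theorem lt_leaf_of_le {x : V} (hu : T.kind u ≠ NodeKind.leaf) (h : u ≤ T.leaf x) :
    u < T.leaf x :=
  lt_of_le_of_ne h (by rintro rfl; exact hu (kind_leaf x))

/-- An internal node above a vertex has a child above that vertex. -/
theorem exists_covBy_le_leaf {x : V} (hu : T.kind u ≠ NodeKind.leaf) (h : u ≤ T.leaf x) :
    ∃ w, u ⋖ w ∧ w ≤ T.leaf x :=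
  exists_covBy_le (lt_leaf_of_le hu h)

theorem exists_covBy_ne (hu : T.kind u ≠ NodeKind.leaf) (v : T.tree) : ∃ w, u ⋖ w ∧ w ≠ v := by
  obtain ⟨a, b, ha, hb, hab⟩ := T.two_children u hu
  by_cases h : a = v
  · exact ⟨b, hb, fun h' => hab (h.trans h'.symm)⟩
  · exact ⟨a, ha, h⟩

theorem descendant_induction {P : T.tree → Prop} (h : ∀ u, (∀ v, u ⋖ v → P v) → P u)
    (u : T.tree) : P u :=
  haveI := T.finite_tree
  WellFoundedGT.induction u fun u ih => h u fun v hv => ih v hv.lt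

theorem exists_le_leaf (u : T.tree) : ∃ x, u ≤ T.leaf x := by
  induction u using descendant_induction with
  | h u ih =>
    by_cases hu : T.kind u = NodeKind.leaf
    · obtain ⟨x, rfl⟩ := (T.kind_eq_leaf_iff u).1 hu
      exact ⟨x, le_rfl⟩
    · obtain ⟨v, -, hv, -⟩ := T.two_children u hu
      obtain ⟨x, hx⟩ := ih v hv
      exact ⟨x, hv.le.trans hx⟩

theorem adj_iff_kind (x y : V) :
    G.Adj x y ↔ T.kind (T.leaf x ⊓ T.leaf y) = NodeKind.series := by
  by_cases h : x = y
  · subst h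
    simp [kind_leaf]
  · exact T.adj_iff x y h

theorem kind_inf_ne_leaf {x y : V} (h : x ≠ y) :
    T.kind (T.leaf x ⊓ T.leaf y) ≠ NodeKind.leaf := fun hk =>
  h (T.leaf_injective ((eq_of_kind_leaf_of_le hk inf_le_left).symm.trans
    (eq_of_kind_leaf_of_le hk inf_le_right)))

theorem kind_eq_parallel (h₁ : T.kind u ≠ NodeKind.leaf) (h₂ : T.kind u ≠ NodeKind.series) :
    T.kind u = NodeKind.parallel := by
  cases h : T.kind u <;> simp_all

theorem not_adj_iff_kind {x y : V} (h : x ≠ y) :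
    ¬ G.Adj x y ↔ T.kind (T.leaf x ⊓ T.leaf y) = NodeKind.parallel := by
  rw [adj_iff_kind (T := T)]
  exact ⟨kind_eq_parallel (kind_inf_ne_leaf h), fun h h' => by simp [h] at h'⟩

theorem isHollow_iff : T.IsHollow M u ↔ ∀ y, u ≤ T.leaf y → y ∉ M :=
  Set.eq_empty_iff_forall_notMem.trans
    ⟨fun h y hy hM => h y ⟨hy, hM⟩, fun h y hy => h y hy.1 hy.2⟩

theorem isFull_iff : T.IsFull M u ↔ ∀ y, u ≤ T.leaf y → y ∈ M := Iff.rfl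

theorem not_isHollow_iff : ¬ T.IsHollow M u ↔ ∃ y, u ≤ T.leaf y ∧ y ∈ M := by
  simp [isHollow_iff]

theorem not_isFull_iff : ¬ T.IsFull M u ↔ ∃ y, u ≤ T.leaf y ∧ y ∉ M := by
  simp [isFull_iff]

theorem isMixed_iff :
    T.IsMixed M u ↔ (∃ y, u ≤ T.leaf y ∧ y ∉ M) ∧ ∃ y, u ≤ T.leaf y ∧ y ∈ M := by
  rw [IsMixed, not_isFull_iff, not_isHollow_iff]

theorem not_isMixed_iff : ¬ T.IsMixed M u ↔ T.IsUniform M u := by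
  simp only [IsMixed, IsUniform]
  tauto

theorem IsHollow.anti (h : T.IsHollow M u) (hN : N ⊆ M) : T.IsHollow N u :=
  isHollow_iff.2 fun y hy hyN => isHollow_iff.1 h y hy (hN hyN)

theorem IsMixed.of_le (h : T.IsMixed M v) (huv : u ≤ v) : T.IsMixed M u := by
  obtain ⟨⟨a, ha, haM⟩, b, hb, hbM⟩ := isMixed_iff.1 h
  exact isMixed_iff.2 ⟨⟨a, huv.trans ha, haM⟩, b, huv.trans hb, hbM⟩

theorem IsMixed.kind_ne_leaf (h : T.IsMixed M u) : T.kind u ≠ NodeKind.leaf := by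
  intro hu
  obtain ⟨⟨a, ha, haM⟩, b, hb, hbM⟩ := isMixed_iff.1 h
  have : a = b := T.leaf_injective
    ((eq_of_kind_leaf_of_le hu ha).symm.trans (eq_of_kind_leaf_of_le hu hb))
  exact haM (this ▸ hbM)

/-- The two differently coloured vertices of a mixed node can be chosen below different children. -/
theorem IsMixed.exists_inf_eq (h : T.IsMixed M u) :
    ∃ a b, a ∈ M ∧ b ∉ M ∧ T.leaf a ⊓ T.leaf b = u := by
  have hu := h.kind_ne_leaf
  obtain ⟨⟨b, hb, hbM⟩, a, ha, haM⟩ := isMixed_iff.1 h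
  obtain ⟨v, hv, hva⟩ := exists_covBy_le_leaf hu ha
  by_cases hvb : v ≤ T.leaf b
  · obtain ⟨w, hw, hwv⟩ := exists_covBy_ne hu v
    obtain ⟨e, he⟩ := exists_le_leaf w
    have hve : ¬ v ≤ T.leaf e := fun h' => hwv (eq_of_covBy_of_le hw hv he h')
    by_cases heM : e ∈ M
    · exact ⟨e, b, heM, hbM, by
        rw [inf_comm]; exact inf_eq_of_covBy hv hvb (hw.le.trans he) hve⟩
    · exact ⟨a, e, haM, heM, inf_eq_of_covBy hv hva (hw.le.trans he) hve⟩
  · exact ⟨a, b, haM, hbM, inf_eq_of_covBy hv hva hb hvb⟩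

/-! ### Coherent sets and cographs. -/

/-- Below `u`, the siblings of a mixed node are hollow if their parent is parallel, and full if it
is series. -/
def IsCoherentBelow (T : Cotree G) (u : T.tree) (M : Set V) : Prop :=
  ∀ v c w : T.tree, u ≤ v → v ⋖ c → v ⋖ w → w ≠ c → T.IsMixed M c →
    (T.kind v = NodeKind.parallel → T.IsHollow M w) ∧
    (T.kind v = NodeKind.series → T.IsFull M w)

/-- A mixed child `c` of `v` is the lowest common ancestor of some `a ∈ M` and `b ∉ M`, and its kind
is opposite to that of `v`. A wrongly coloured `y` below a sibling would give the induced path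
y–x–a–b if `v` is parallel, and x–a–y–b if `v` is series. -/
theorem isCoherentBelow_bot_of_isCograph (hG : IsCograph G) (h : IsCograph (addVertex G M)) :
    T.IsCoherentBelow ⊥ M := by
  obtain ⟨h₁, h₂⟩ := (isCograph_addVertex_iff hG M).1 h
  intro v c w _ hc hw hwc hmix
  obtain ⟨a, b, haM, hbM, hab⟩ := hmix.exists_inf_eq
  have hca : c ≤ T.leaf a := hab ▸ inf_le_left
  have hcb : c ≤ T.leaf b := hab ▸ inf_le_right
  have hinf : ∀ {y z}, w ≤ T.leaf y → c ≤ T.leaf z → T.leaf y ⊓ T.leaf z = v := fun hy hz =>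
    inf_eq_of_covBy hw hy (hc.le.trans hz) fun h' => hwc (eq_of_covBy_of_le hw hc h' hz)
  have hck := hmix.kind_ne_leaf
  have hvc := T.kind_ne_of_covBy v c hc
  constructor
  · intro hv
    refine isHollow_iff.2 fun y hy hyM => hbM (h₂ y a b ?_ ?_ ?_ hyM haM)
    · rw [adj_iff_kind (T := T), hinf hy hca, hv]; simp
    · rw [adj_iff_kind (T := T), hab]
      by_contra hs
      exact hvc (hv.trans (kind_eq_parallel hck hs).symm)
    · rw [adj_iff_kind (T := T), hinf hy hcb, hv]; simp
  · intro hv y hy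
    by_contra hyM
    refine hbM (h₁ a y b ?_ ?_ ?_ haM hyM)
    · rw [adj_iff_kind (T := T), inf_comm, hinf hy hca, hv]
    · rw [adj_iff_kind (T := T), hinf hy hcb, hv]
    · rw [adj_iff_kind (T := T), hab]
      exact fun hs => hvc (hv.trans hs.symm)

/-- If `a` and `c` are differently coloured and `b` branches off strictly above their lowest common
ancestor, then the colour of `b` is dictated by the kind of the branching node. -/
theorem IsCoherentBelow.mem_of_inf_lt (h : T.IsCoherentBelow ⊥ M) {a b c : V}
    (hac : ¬ (a ∈ M ↔ c ∈ M)) (hlt : T.leaf a ⊓ T.leaf b < T.leaf a ⊓ T.leaf c) :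
    (T.kind (T.leaf a ⊓ T.leaf b) = NodeKind.parallel → b ∉ M) ∧
    (T.kind (T.leaf a ⊓ T.leaf b) = NodeKind.series → b ∈ M) := by
  obtain ⟨e, he, hec⟩ := exists_covBy_le hlt
  obtain ⟨w, hw, hwb⟩ := exists_covBy_le_leaf (kind_ne_leaf_of_lt hlt)
    (inf_le_right : T.leaf a ⊓ T.leaf b ≤ T.leaf b)
  have hea := hec.trans inf_le_left
  have hec' := hec.trans inf_le_right
  have hwe : w ≠ e := by
    rintro rfl
    exact (le_inf hea hwb).not_gt he.lt
  have hmix : T.IsMixed M e := by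
    rw [isMixed_iff]
    by_cases ha : a ∈ M
    · exact ⟨⟨c, hec', by tauto⟩, a, hea, ha⟩
    · exact ⟨⟨a, hea, ha⟩, c, hec', by tauto⟩
  obtain ⟨h₁, h₂⟩ := h _ e w bot_le he hw hwe hmix
  exact ⟨fun hk => isHollow_iff.1 (h₁ hk) b hwb, fun hk => h₂ hk hwb⟩

/-- In either type of path through the new vertex, one of the three pairwise lowest common ancestors
differs in kind from the other two, so it is strictly the lowest. It belongs to the two differently
coloured vertices, and coherence then contradicts the colour of the third. -/
theorem IsCoherentBelow.isCograph (hG : IsCograph G) (h : T.IsCoherentBelow ⊥ M) :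
    IsCograph (addVertex G M) := by
  rw [isCograph_addVertex_iff hG]
  constructor
  · intro a b c hab hbc hac ha hb
    by_contra hc
    have hne : a ≠ c := by rintro rfl; exact hc ha
    rw [adj_iff_kind (T := T)] at hab hbc
    rw [not_adj_iff_kind (T := T) hne] at hac
    refine hb ((h.mem_of_inf_lt (c := c) (by tauto) (inf_lt_inf_of_ne ?_ ?_)).2 hab)
    · exact fun e => by rw [e, hab] at hac; cases hac
    · exact fun e => by rw [e, hbc] at hac; cases hac
  · intro a b c hab hbc hac ha hb
    by_contra hc
    have hne : b ≠ a := by rintro rfl; exact hac hbc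
    have hne' : a ≠ c := by rintro rfl; exact hab hbc.symm
    rw [G.adj_comm, not_adj_iff_kind (T := T) hne] at hab
    rw [not_adj_iff_kind (T := T) hne'] at hac
    rw [adj_iff_kind (T := T)] at hbc
    refine (h.mem_of_inf_lt (a := b) (b := a) (c := c) (by tauto)
      (inf_lt_inf_of_ne ?_ ?_)).1 hab ha
    · exact fun e => by rw [e, hab] at hbc; cases hbc
    · exact fun e => by rw [e, hac] at hbc; cases hbc

theorem isCograph_addVertex_iff_isCoherentBelow (hG : IsCograph G) :
    IsCograph (addVertex G M) ↔ T.IsCoherentBelow ⊥ M :=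
  ⟨isCoherentBelow_bot_of_isCograph hG, fun h => h.isCograph hG⟩

theorem isCompletionMinimalInsertionNode_iff (hG : IsCograph G) :
    T.IsCompletionMinimalInsertionNode N u ↔
      ∃ M, Minimal (fun M => T.IsCoherentBelow ⊥ M ∧ N ⊆ M) M ∧ T.IsInsertionNode M u := by
  simp only [← isCograph_addVertex_iff_isCoherentBelow hG,
    ← isMinimalConstrainedCompletion_addVertex_iff]
  constructor
  · rintro ⟨H, hH, hu⟩
    exact ⟨newNeighbors H, hH.1.eq_addVertex ▸ hH, hu⟩
  · rintro ⟨M, hM, hu⟩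
    exact ⟨_, hM, hu⟩

/-- Outside a mixed node, a coherent set is determined by the lowest common ancestors. -/
theorem IsCoherentBelow.mem_iff_of_isMixed (h : T.IsCoherentBelow ⊥ M) (hu : T.IsMixed M u)
    {y : V} (hy : ¬ u ≤ T.leaf y) : y ∈ M ↔ T.kind (T.leaf y ⊓ u) = NodeKind.series := by
  have hlt : T.leaf y ⊓ u < u := lt_of_le_of_ne inf_le_right fun e => hy (e ▸ inf_le_left)
  obtain ⟨c, hc, hcu⟩ := exists_covBy_le hlt
  obtain ⟨w, hw, hwy⟩ := exists_covBy_le_leaf (kind_ne_leaf_of_lt hlt)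
    (inf_le_left : T.leaf y ⊓ u ≤ T.leaf y)
  have hwc : w ≠ c := by
    rintro rfl
    exact (le_inf hwy hcu).not_gt hw.lt
  obtain ⟨h₁, h₂⟩ := h _ c w bot_le hc hw hwc (hu.of_le hcu)
  refine ⟨fun hyM => ?_, fun hk => h₂ hk hwy⟩
  by_contra hk
  exact isHollow_iff.1 (h₁ (kind_eq_parallel (kind_ne_leaf_of_lt hlt) hk)) y hwy hyM

/-! ### Gluing a local set into the dictated neighbourhood, and eligibility. -/

/-- The neighbourhood that agrees with `M` below `u` and is dictated by lowest common ancestors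
with `u` elsewhere. -/
def glue (T : Cotree G) (u : T.tree) (M : Set V) : Set V :=
  {y | (u ≤ T.leaf y ∧ y ∈ M) ∨ (¬ u ≤ T.leaf y ∧ T.kind (T.leaf y ⊓ u) = NodeKind.series)}

theorem mem_glue_of_le {y : V} (h : u ≤ T.leaf y) : y ∈ T.glue u M ↔ y ∈ M := by
  simp [glue, h]

theorem mem_glue_of_not_le {y : V} (h : ¬ u ≤ T.leaf y) :
    y ∈ T.glue u M ↔ T.kind (T.leaf y ⊓ u) = NodeKind.series := by
  simp [glue, h]

theorem isFull_congr {M' : Set V} (h : ∀ y, u ≤ T.leaf y → (y ∈ M ↔ y ∈ M')) :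
    T.IsFull M u ↔ T.IsFull M' u :=
  forall_congr' fun y => forall_congr' fun hy => h y hy

theorem isHollow_congr {M' : Set V} (h : ∀ y, u ≤ T.leaf y → (y ∈ M ↔ y ∈ M')) :
    T.IsHollow M u ↔ T.IsHollow M' u := by
  rw [isHollow_iff, isHollow_iff]
  exact forall_congr' fun y => forall_congr' fun hy => not_congr (h y hy)

theorem isMixed_congr {M' : Set V} (h : ∀ y, u ≤ T.leaf y → (y ∈ M ↔ y ∈ M')) :
    T.IsMixed M u ↔ T.IsMixed M' u :=
  and_congr (not_congr (isFull_congr h)) (not_congr (isHollow_congr h))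

theorem IsCoherentBelow.congr {M' : Set V} (hM : T.IsCoherentBelow u M)
    (h : ∀ y, u ≤ T.leaf y → (y ∈ M ↔ y ∈ M')) : T.IsCoherentBelow u M' := by
  intro v c w hv hc hw hwc hmix
  have hcongr : ∀ e, v ⋖ e → ∀ y, e ≤ T.leaf y → (y ∈ M ↔ y ∈ M') :=
    fun e he y hy => h y (hv.trans (he.le.trans hy))
  rw [← isHollow_congr (hcongr w hw), ← isFull_congr (hcongr w hw)]
  exact hM v c w hv hc hw hwc ((isMixed_congr (hcongr c hc)).2 hmix)

/-- A set that is coherent below `d` is coherent below an ancestor `u` of `d` if the nodes that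
branch off in between are uniform in the way their parent demands. -/
theorem IsCoherentBelow.extend {d : T.tree} (hd : T.IsCoherentBelow d M)
    (hunif : ∀ v c, u ≤ v → v ⋖ c → ¬ c ≤ d → ¬ d ≤ v → T.IsUniform M c)
    (hpath : ∀ v c w, u ≤ v → v ⋖ c → c ≤ d → v ⋖ w → w ≠ c →
      (T.kind v = NodeKind.parallel → T.IsHollow M w) ∧
      (T.kind v = NodeKind.series → T.IsFull M w)) :
    T.IsCoherentBelow u M := by
  intro v c w hv hc hw hwc hmix
  by_cases hdv : d ≤ v
  · exact hd v c w hdv hc hw hwc hmix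
  · by_cases hcd : c ≤ d
    · exact hpath v c w hv hc hcd hw hwc
    · exact absurd hmix (not_isMixed_iff.2 (hunif v c hv hc hcd hdv))

/-- All vertices below a node incomparable with `u` have the same lowest common ancestor with `u`,
so the glued set is uniform there. -/
theorem IsCoherentBelow.glue (h : T.IsCoherentBelow u M) :
    T.IsCoherentBelow ⊥ (T.glue u M) := by
  refine (h.congr fun y hy => (mem_glue_of_le hy).symm).extend ?_ ?_
  · intro v c _ hc hcu huv
    have hy : ∀ y, c ≤ T.leaf y → ¬ u ≤ T.leaf y := fun y hy hu =>
      (le_or_le_of_covBy hc hy hu).elim huv hcu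
    have hinf : ∀ y, c ≤ T.leaf y → T.leaf y ⊓ u = c ⊓ u := fun y hcy => by
      refine le_antisymm (le_inf ?_ inf_le_right) (inf_le_inf_right u hcy)
      rcases le_total_of_le (inf_le_left : T.leaf y ⊓ u ≤ _) hcy with h' | h'
      · exact h'
      · exact absurd (h'.trans inf_le_right) hcu
    by_cases hk : T.kind (c ⊓ u) = NodeKind.series
    · exact Or.inl fun y hcy => (mem_glue_of_not_le (hy y hcy)).2 (hinf y hcy ▸ hk)
    · exact Or.inr (isHollow_iff.2 fun y hcy hyM =>
        hk (hinf y hcy ▸ (mem_glue_of_not_le (hy y hcy)).1 hyM))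
  · intro v c w _ hc hcu hw hwc
    have hwu : ¬ w ≤ u := fun h' => hwc (eq_of_covBy_of_le hw hc h' hcu)
    have hy : ∀ y, w ≤ T.leaf y → ¬ u ≤ T.leaf y := fun y hy hu =>
      hwc (eq_of_covBy_of_le hw hc hy (hcu.trans hu))
    have hinf : ∀ y, w ≤ T.leaf y → T.leaf y ⊓ u = v := fun y hwy =>
      inf_eq_of_covBy hw hwy (hc.le.trans hcu) hwu
    constructor
    · intro hk
      refine isHollow_iff.2 fun y hwy hyM => ?_
      rw [mem_glue_of_not_le (hy y hwy), hinf y hwy, hk] at hyM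
      simp at hyM
    · intro hk y hwy
      rw [mem_glue_of_not_le (hy y hwy), hinf y hwy, hk]

/-- An eligible node lets the neighbourhood elsewhere be dictated by lowest common ancestors. -/
theorem IsEligible.subset_glue (hu : T.IsEligible N u) (h : ∀ y ∈ N, u ≤ T.leaf y → y ∈ M) :
    N ⊆ T.glue u M := by
  intro y hyN
  by_cases hy : u ≤ T.leaf y
  · exact (mem_glue_of_le hy).2 (h y hyN hy)
  · rw [mem_glue_of_not_le hy]
    have hlt : T.leaf y ⊓ u < u := lt_of_le_of_ne inf_le_right fun e => hy (e ▸ inf_le_left)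
    obtain ⟨w, hw, hwy⟩ := exists_covBy_le_leaf (kind_ne_leaf_of_lt hlt)
      (inf_le_left : T.leaf y ⊓ u ≤ T.leaf y)
    by_contra hk
    exact isHollow_iff.1 (hu _ hlt (kind_eq_parallel (kind_ne_leaf_of_lt hlt) hk) w hw
      fun hwu => (le_inf hwy hwu).not_gt hw.lt) y hwy hyN

/-- A child of an eligible parallel node is eligible if its siblings are hollow. -/
theorem IsEligible.of_covBy (hu : T.IsEligible N u) (hv : u ⋖ v)
    (h : ∀ w, u ⋖ w → w ≠ v → T.IsHollow N w) : T.IsEligible N v := by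
  intro a ha hk w hw hwv
  rcases le_or_le_of_covBy hv le_rfl ha.le with hau | hva
  · rcases hau.eq_or_lt with rfl | hau
    · exact h w hw fun e => hwv e.le
    · exact hu a hau hk w hw fun hwu => hwv (hwu.trans hv.le)
  · exact absurd ha hva.not_gt

/-! ### Completion-forced nodes. -/

/-- Completion-forced nodes are full in every completion. -/
theorem IsCompletionForced.isFull (hM : T.IsCoherentBelow ⊥ M) (hN : N ⊆ M)
    (h : T.IsCompletionForced N u) : T.IsFull M u := by
  induction h with
  | full u h => exact h.trans hN
  | parallel u hu h =>
    intro y hy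
    have hk : T.kind u ≠ NodeKind.leaf := by simp [hu]
    obtain ⟨c, hc, hcy⟩ := exists_covBy_le_leaf hk hy
    by_contra hyM
    -- A mixed child would make a sibling hollow, but no child of `u` is hollow.
    have hmix : T.IsMixed M c :=
      ⟨not_isFull_iff.2 ⟨y, hcy, hyM⟩, fun hh => h c hc (hh.anti hN)⟩
    obtain ⟨w, hw, hwc⟩ := exists_covBy_ne hk c
    exact h w hw (((hM u c w bot_le hc hw hwc hmix).1 hu).anti hN)
  | series u hu h ih =>
    intro y hy
    obtain ⟨c, hc, hcy⟩ := exists_covBy_le_leaf (by simp [hu]) hy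
    exact ih c hc hcy

/-- Below a node that is not completion-forced there is a completion that does not fill it. -/
theorem exists_not_isFull_of_not_isCompletionForced (hu : ¬ T.IsCompletionForced N u) :
    ∃ M, T.IsCoherentBelow u M ∧ (∀ y ∈ N, u ≤ T.leaf y → y ∈ M) ∧ ¬ T.IsFull M u := by
  induction u using descendant_induction with
  | h u ih =>
    rcases hk : T.kind u with _ | _ | _
    · obtain ⟨y, hy, hyN⟩ := not_isFull_iff.1 fun h => hu (.full u h)
      refine ⟨N, fun v c w hv hc => ?_, fun y hyN _ => hyN, not_isFull_iff.2 ⟨y, hy, hyN⟩⟩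
      exact absurd hk (kind_ne_leaf_of_lt (hv.trans_lt hc.lt))
    · obtain ⟨d, hd, hdN⟩ : ∃ d, u ⋖ d ∧ T.IsHollow N d := by
        by_contra! h
        exact hu (.parallel u hk h)
      -- Omitting exactly the hollow child `d` leaves no strict descendant of `u` mixed.
      refine ⟨{y | ¬ d ≤ T.leaf y}, fun v c w hv hc hw hwc hmix => ?_,
        fun y hyN _ hdy => isHollow_iff.1 hdN y hdy hyN, ?_⟩
      · obtain ⟨⟨a, ha, haM⟩, b, hb, hbM⟩ := isMixed_iff.1 hmix
        rcases le_or_le_of_covBy hd (not_not.1 haM) ha with h | h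
        · exact absurd (hv.trans_lt hc.lt) h.not_gt
        · exact absurd (h.trans hb) hbM
      · obtain ⟨y, hy⟩ := exists_le_leaf d
        exact not_isFull_iff.2 ⟨y, hd.le.trans hy, not_not.2 hy⟩
    · obtain ⟨d, hd, hdN⟩ : ∃ d, u ⋖ d ∧ ¬ T.IsCompletionForced N d := by
        by_contra! h
        exact hu (.series u hk h)
      obtain ⟨M, hM, hNM, hfull⟩ := ih d hd hdN
      -- The siblings of `d` are filled, as the series node `u` demands.
      refine ⟨{y | d ≤ T.leaf y → y ∈ M}, ?_, fun y hyN _ hdy => hNM y hyN hdy, ?_⟩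
      · refine (hM.congr (M' := {y | d ≤ T.leaf y → y ∈ M}) fun y hy => by simp [hy]).extend
          ?_ ?_
        · intro v c hv hc hcd hdv
          exact Or.inl fun y hcy hdy => ((le_or_le_of_covBy hc hcy hdy).elim hdv hcd).elim
        · intro v c w hv hc hcd hw hwc
          have hvu : v = u := by
            rcases le_or_le_of_covBy hd le_rfl (hc.le.trans hcd) with h | h
            · exact le_antisymm h hv
            · exact absurd (hc.lt.trans_le hcd) h.not_gt
          subst hvu
          have hcd' : c = d := eq_of_covBy_of_le hc hd hcd le_rfl
          subst hcd'
          exact ⟨fun h => by simp [hk] at h,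
            fun _ y hwy hcy => (hwc (eq_of_covBy_of_le hw hc hwy hcy)).elim⟩
      · obtain ⟨y, hy, hyM⟩ := not_isFull_iff.1 hfull
        exact not_isFull_iff.2 ⟨y, hd.le.trans hy, fun h => hyM (h hy)⟩

/-! ### Necessity of the conditions. -/

theorem IsInsertionNode.isEligible (h : T.IsInsertionNode M u) (hN : N ⊆ M) :
    T.IsEligible N u := by
  intro v hv hk w hw hwu
  refine isHollow_iff.2 fun y hwy hyN => ?_
  have hy : ¬ u ≤ T.leaf y := fun hu =>
    (le_or_le_of_covBy hw hwy hu).elim (fun h' => h'.not_gt hv) hwu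
  have := (h.2.2 y hy).1 (hN hyN)
  rw [inf_eq_of_covBy hw hwy hv.le hwu, hk] at this
  simp at this

/-- A minimal completion is contained in every glued neighbourhood below it that belongs to an
eligible node. -/
theorem subset_glue_of_minimal (hmin : Minimal (fun M => T.IsCoherentBelow ⊥ M ∧ N ⊆ M) M)
    {M' : Set V} (hel : T.IsEligible N u) (hM' : T.IsCoherentBelow u M')
    (hN : ∀ y ∈ N, u ≤ T.leaf y → y ∈ M') (hle : T.glue u M' ⊆ M) : M ⊆ T.glue u M' :=
  hmin.2 ⟨hM'.glue, hel.subset_glue hN⟩ hle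

/-- Otherwise emptying `u` and keeping `M` elsewhere would give a strictly smaller completion. -/
theorem IsInsertionNode.not_isHollow (h : T.IsInsertionNode M u)
    (hmin : Minimal (fun M => T.IsCoherentBelow ⊥ M ∧ N ⊆ M) M) : ¬ T.IsHollow N u := by
  intro hu
  obtain ⟨y, hy, hyM⟩ := not_isHollow_iff.1 h.1.2
  have hempty : T.IsCoherentBelow u (∅ : Set V) := fun v c w _ _ _ _ hmix =>
    absurd (isHollow_iff.2 fun _ _ => Set.notMem_empty _) hmix.2
  refine (mem_glue_of_le hy).1 (subset_glue_of_minimal hmin (h.isEligible hmin.1.2) hempty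
    (fun z hz huz => isHollow_iff.1 hu z huz hz) ?_ hyM)
  rintro z (⟨-, hz⟩ | ⟨huz, hz⟩)
  · exact hz.elim
  · exact (h.2.2 z huz).2 hz

/-- Otherwise a set that does not fill `v` can be glued at `v`. As `u` is parallel, this empties the
siblings of `v` and agrees with `M` outside `u`, so the completion shrinks strictly. -/
theorem IsInsertionNode.isCompletionForced_of_isEligible (h : T.IsInsertionNode M u)
    (hmin : Minimal (fun M => T.IsCoherentBelow ⊥ M ∧ N ⊆ M) M)
    (hk : T.kind u = NodeKind.parallel) (hv : u ⋖ v) (hel : T.IsEligible N v) :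
    T.IsCompletionForced N v := by
  by_contra hforced
  obtain ⟨M', hM', hNM', hfull⟩ := exists_not_isFull_of_not_isCompletionForced hforced
  -- The siblings of `v` are hollow by eligibility, so if `v` were hollow too, `u` would be.
  have hvM : T.IsFull M v := by
    refine (h.2.1 v hv).resolve_right fun hhol => h.not_isHollow hmin ?_
    refine isHollow_iff.2 fun y hy hyN => ?_
    obtain ⟨w, hw, hwy⟩ := exists_covBy_le_leaf (by simp [hk]) hy
    by_cases hwv : w ≤ v
    · have : w = v := eq_of_covBy_of_le hw hv hwv le_rfl
      exact isHollow_iff.1 hhol y (this ▸ hwy) (hmin.1.2 hyN)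
    · exact isHollow_iff.1 (hel u hv.lt hk w hw hwv) y hwy hyN
  obtain ⟨y, hy, hyM'⟩ := not_isFull_iff.1 hfull
  refine hyM' ((mem_glue_of_le hy).1 (subset_glue_of_minimal hmin hel hM' hNM' ?_ (hvM hy)))
  rintro z (⟨hvz, -⟩ | ⟨hvz, hz⟩)
  · exact hvM hvz
  · by_cases huz : u ≤ T.leaf z
    · obtain ⟨w, hw, hwz⟩ := exists_covBy_le_leaf (by simp [hk]) huz
      have hwv : ¬ w ≤ v := fun hwv => hvz (eq_of_covBy_of_le hw hv hwv le_rfl ▸ hwz)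
      rw [inf_eq_of_covBy hw hwz hv.le hwv, hk] at hz
      simp at hz
    · rw [h.2.2 z huz]
      have : T.leaf z ⊓ v = T.leaf z ⊓ u := by
        refine le_antisymm (le_inf inf_le_left ?_) (inf_le_inf_left _ hv.le)
        rcases le_or_le_of_covBy hv le_rfl (inf_le_right : T.leaf z ⊓ v ≤ v) with h' | h'
        · exact h'
        · exact absurd (h'.trans inf_le_left) hvz
      rwa [← this]

/-! ### Sufficiency: filling the non-hollow children. -/

/-- The completion that fills exactly the non-hollow children of `u`. -/
def fillChildren (T : Cotree G) (N : Set V) (u : T.tree) : Set V :=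
  T.glue u {y | ∀ c, u ⋖ c → c ≤ T.leaf y → ¬ T.IsHollow N c}

theorem mem_fillChildren_of_covBy {y : V} (hv : u ⋖ v) (hy : v ≤ T.leaf y) :
    y ∈ T.fillChildren N u ↔ ¬ T.IsHollow N v := by
  rw [fillChildren, mem_glue_of_le (hv.le.trans hy)]
  exact ⟨fun h => h v hv hy, fun h c hc hcy => eq_of_covBy_of_le hv hc hy hcy ▸ h⟩

theorem isUniform_fillChildren (hv : u ⋖ v) : T.IsUniform (T.fillChildren N u) v := by
  by_cases h : T.IsHollow N v
  · exact Or.inr (isHollow_iff.2 fun y hy hyM => (mem_fillChildren_of_covBy hv hy).1 hyM h)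
  · exact Or.inl fun y hy => (mem_fillChildren_of_covBy hv hy).2 h

theorem isCoherentBelow_fillChildren : T.IsCoherentBelow ⊥ (T.fillChildren N u) := by
  have h : T.IsCoherentBelow u (T.fillChildren N u) := fun v c w hv hc _ _ hmix => by
    obtain ⟨d, hd, hdc⟩ := exists_covBy_le (hv.trans_lt hc.lt)
    exact absurd (hmix.of_le hdc) (not_isMixed_iff.2 (isUniform_fillChildren hd))
  exact (h.congr fun y hy => mem_glue_of_le hy).glue

theorem IsEligible.subset_fillChildren (hu : T.IsEligible N u) : N ⊆ T.fillChildren N u :=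
  hu.subset_glue fun y hyN _ _ _ hcy => not_isHollow_iff.2 ⟨y, hcy, hyN⟩

theorem isMixed_fillChildren (hel : T.IsEligible N u) (hu : ¬ T.IsHollow N u) (hv : u ⋖ v)
    (hhol : T.IsHollow N v) : T.IsMixed (T.fillChildren N u) u := by
  obtain ⟨a, ha, haN⟩ := not_isHollow_iff.1 hu
  obtain ⟨b, hb⟩ := exists_le_leaf v
  exact isMixed_iff.2 ⟨⟨b, hv.le.trans hb, fun h => (mem_fillChildren_of_covBy hv hb).1 h hhol⟩,
    a, ha, hel.subset_fillChildren haN⟩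

/-- Filling the non-hollow children of `u` is a minimal completion as soon as no smaller completion
has a mixed child of `u`. -/
theorem isCompletionMinimalInsertionNode_of_forall_not_isMixed (hG : IsCograph G)
    (hel : T.IsEligible N u) (hu : ¬ T.IsHollow N u) (hv : u ⋖ v) (hhol : T.IsHollow N v)
    (h : ∀ M, T.IsCoherentBelow ⊥ M → N ⊆ M → M ⊆ T.fillChildren N u →
      ∀ c, u ⋖ c → ¬ T.IsMixed M c) :
    T.IsCompletionMinimalInsertionNode N u := by
  rw [isCompletionMinimalInsertionNode_iff hG]
  have hmixed := isMixed_fillChildren hel hu hv hhol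
  refine ⟨T.fillChildren N u,
    ⟨⟨isCoherentBelow_fillChildren, hel.subset_fillChildren⟩, ?_⟩,
    hmixed, fun c hc => isUniform_fillChildren hc, fun y hy => mem_glue_of_not_le hy⟩
  rintro M ⟨hM, hNM⟩ hle y hy
  by_cases huy : u ≤ T.leaf y
  · obtain ⟨c, hc, hcy⟩ := exists_covBy_le_leaf hmixed.kind_ne_leaf huy
    have hcN := (mem_fillChildren_of_covBy hc hcy).1 hy
    exact (not_isMixed_iff.1 (h M hM hNM hle c hc)).resolve_right
      (fun hh => hcN (hh.anti hNM)) hcy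
  -- The smaller set still misses a vertex below `u` and meets `N` there, so `u` stays mixed and
  -- dictates membership outside.
  · have hMmix : T.IsMixed M u := by
      obtain ⟨b, hb, hbM⟩ := (isMixed_iff.1 hmixed).1
      exact ⟨not_isFull_iff.2 ⟨b, hb, fun h' => hbM (hle h')⟩, fun hh => hu (hh.anti hNM)⟩
    rw [hM.mem_iff_of_isMixed hMmix huy]
    exact (mem_glue_of_not_le huy).1 hy

end Cotree

open Cotree in
theorem lemma6 {V : Type*} (G : SimpleGraph V) (hG : IsCograph G) (T : Cotree G)
    (N : Set V) (u : T.tree) :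
    T.IsCompletionMinimalInsertionNode N u ↔
      T.IsEligible N u ∧ ¬ T.IsHollow N u ∧ ¬ T.IsCompletionForced N u ∧
        ((T.kind u = NodeKind.series ∧ ∃ v : T.tree, u ⋖ v ∧ T.IsHollow N v) ∨
          (T.kind u = NodeKind.parallel ∧
            ¬ ∃ v : T.tree, u ⋖ v ∧ T.IsEligible N v ∧ ¬ T.IsCompletionForced N v)) := by
  constructor
  · rw [isCompletionMinimalInsertionNode_iff hG]
    rintro ⟨M, hmin, hins⟩
    refine ⟨hins.isEligible hmin.1.2, hins.not_isHollow hmin,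
      fun hf => hins.1.1 (hf.isFull hmin.1.1 hmin.1.2), ?_⟩
    by_cases hk : T.kind u = NodeKind.series
    · obtain ⟨y, hy, hyM⟩ := not_isFull_iff.1 hins.1.1
      obtain ⟨c, hc, hcy⟩ := exists_covBy_le_leaf (by simp [hk]) hy
      exact Or.inl ⟨hk, c, hc,
        ((hins.2.1 c hc).resolve_left fun hf => hyM (hf hcy)).anti hmin.1.2⟩
    · have hk' := kind_eq_parallel hins.1.kind_ne_leaf hk
      refine Or.inr ⟨hk', ?_⟩
      rintro ⟨v, hv, hel, hnf⟩
      exact hnf (hins.isCompletionForced_of_isEligible hmin hk' hv hel)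
  · rintro ⟨hel, hhol, hnf, ⟨hk, v, hv, hvN⟩ | ⟨hk, hno⟩⟩
    · refine isCompletionMinimalInsertionNode_of_forall_not_isMixed hG hel hhol hv hvN ?_
      intro M hM _ hle c hc hmix
      -- The hollow child `v` is disjoint from `M`: it is not mixed itself, and a mixed sibling
      -- would force it full.
      by_cases hvc : v = c
      · subst hvc
        obtain ⟨y, hy, hyM⟩ := not_isHollow_iff.1 hmix.2
        exact (mem_fillChildren_of_covBy hv hy).1 (hle hyM) hvN
      · obtain ⟨y, hy⟩ := exists_le_leaf v
        exact (mem_fillChildren_of_covBy hv hy).1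
          (hle ((hM u c v bot_le hc hv hvc hmix).2 hk hy)) hvN
    · obtain ⟨v, hv, hvN⟩ : ∃ v, u ⋖ v ∧ T.IsHollow N v := by
        by_contra! h
        exact hnf (.parallel u hk h)
      refine isCompletionMinimalInsertionNode_of_forall_not_isMixed hG hel hhol hv hvN ?_
      intro M hM hNM _ c hc hmix
      -- A mixed child has hollow siblings and so inherits eligibility. It is then forced, hence
      -- full, or it contradicts `hno`.
      have hcel : T.IsEligible N c := hel.of_covBy hc fun w hw hwc =>
        ((hM u c w bot_le hc hw hwc hmix).1 hk).anti hNM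
      by_cases hcf : T.IsCompletionForced N c
      · exact hmix.1 (hcf.isFull hM hNM)
      · exact hno ⟨c, hc, hcel, hcf⟩
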